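/- Let $\mathcal Q$ and $U$ be finite index sets, let $A=(a_e)_{e\in U}\in\mathbb R^{\mathcal Q\times U}$ be a real matrix with columns $a_e$ and with rank $|\mathcal Q|$, and let $k$ be an integer with $1\le k\le m:=|\mathcal Q|$. For an $m\times m$ positive semidefinite matrix $\Sigma$ with eigenvalues $\sigma_1\ge\dots\ge\sigma_m\ge 0$ put $\|\Sigma\|_{(k)}=\sigma_1+\dots+\sigma_k$ (the Ky Fan $k$-norm), and $$h_k(\Sigma)=\sum_{i=1}^{t}\sigma_i^{1/2}+\sqrt{k-t}\,\Bigl(\sum_{i>t}\sigma_i\Bigr)^{1/2},$$ where $t$ is the unique integer with $0\le t\le k-1$ and $$\sigma_t>\frac{\sum_{i>t}\sigma_i}{k-t}\ge\sigma_{t+1}\qquad(\text{with the convention }\sigma_0=\infty).$$ Let $\mu$ be the optimal value of the program $$\min\ \|X^{-1}\|_{(k)}\quad\text{subject to}\quad X\succ 0,\qquad a_e^{T}Xa_e\le 1\ \text{ for all } e\in U,$$ where $X$ ranges over the real symmetric $\mathcal Q\times\mathcal Q$ matrices. Then the minimum is attained, and $$\mu=\max\bigl\{\,h_k(AQA^{T})^2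 : Q\in\mathbb R^{U\times U}\text{ diagonal},\ Q\succeq 0,\ \operatorname{tr}Q=1\,\bigr\},$$ where the maximum is attained as well. -/

import Mathlib

namespace KyFanDual

open Matrix

variable {m : Type*} [Fintype m] [DecidableEq m]

/-- The eigenvalues of a real symmetric matrix `M`, with multiplicity, in decreasing order and
counted from `0`: `eig M i` is the `(i+1)`-st largest eigenvalue for `i < |m|`, and `0` for
`i ≥ |m|`. (It is only used for symmetric `M`; it is `0` otherwise.) For a positive semidefinite
matrix these are also its singular values. -/
noncomputable def eig (M : Matrix m m ℝ) (i : ℕ) : ℝ :=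
  if h : M.IsHermitian ∧ i < Fintype.card m then h.1.eigenvalues₀ ⟨i, h.2⟩ else 0

/-- The Ky Fan `k`-norm of a positive semidefinite matrix: the sum of its `k` largest
eigenvalues. -/
noncomputable def kyFan (k : ℕ) (M : Matrix m m ℝ) : ℝ :=
  ∑ i ∈ Finset.range k, eig M i

/-- The tail sum `∑_{i > t} σ_i` of the eigenvalues `σ₁ ≥ σ₂ ≥ …` of `M`: all but the `t`
largest ones. -/
noncomputable def tail (M : Matrix m m ℝ) (t : ℕ) : ℝ :=
  ∑ i ∈ Finset.Ico t (Fintype.card m), eig M i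

/-- `0 ≤ t ≤ k - 1` and `σ_t > (∑_{i > t} σ_i) / (k - t) ≥ σ_{t+1}`, where `σ₀ = ∞`
(so the first inequality is only asked for when `t` is a successor). Here `σ_i = eig M (i-1)`. -/
def IsThreshold (k : ℕ) (M : Matrix m m ℝ) (t : ℕ) : Prop :=
  t < k ∧ (∀ s, t = s + 1 → tail M t / ((k : ℝ) - t) < eig M s) ∧
    eig M t ≤ tail M t / ((k : ℝ) - t)

/-- The integer `t` of `IsThreshold`; by `existsUnique_isThreshold` there is exactly one for
positive semidefinite `M` and `1 ≤ k ≤ |m|`. -/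
noncomputable def threshold (k : ℕ) (M : Matrix m m ℝ) : ℕ :=
  sInf {t | IsThreshold k M t}

/-- `h_k(M) = ∑_{i ≤ t} σ_i^{1/2} + (k - t)^{1/2} (∑_{i > t} σ_i)^{1/2}`. -/
noncomputable def hFun (k : ℕ) (M : Matrix m m ℝ) : ℝ :=
  ∑ i ∈ Finset.range (threshold k M), √(eig M i) +
    √((k : ℝ) - threshold k M) * √(tail M (threshold k M))

/-- The values of the program: minimize `‖X⁻¹‖_(k)` subject to `X ≻ 0` and `a_eᵀ X a_e ≤ 1` for
every column `a_e` of `A`. -/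
def primalValues {U : Type*} (k : ℕ) (A : Matrix m U ℝ) : Set ℝ :=
  {v | ∃ X : Matrix m m ℝ, X.PosDef ∧ (∀ e : U, A.col e ⬝ᵥ X *ᵥ A.col e ≤ 1) ∧
    v = kyFan k X⁻¹}

/-- The values of the program: maximize `h_k(A Q Aᵀ)²` over diagonal `Q ⪰ 0` with `tr Q = 1`. -/
def dualValues {U : Type*} [Fintype U] (k : ℕ) (A : Matrix m U ℝ) : Set ℝ :=
  {v | ∃ Q : Matrix U U ℝ, Q.PosSemidef ∧ Q.IsDiag ∧ Q.trace = 1 ∧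
    v = hFun k (A * Q * Aᵀ) ^ 2}

/-! The threshold index is well defined. -/

theorem eig_nonneg {M : Matrix m m ℝ} (hM : M.PosSemidef) (i : ℕ) : 0 ≤ eig M i := by
  unfold eig
  split_ifs with h
  · have := hM.eigenvalues_nonneg ((Fintype.equivOfCardEq (Fintype.card_fin _)) ⟨i, h.2⟩)
    simpa [Matrix.IsHermitian.eigenvalues] using this
  · exact le_rfl

theorem eig_antitone {M : Matrix m m ℝ} (hM : M.PosSemidef) : Antitone (eig M) := by
  intro i j hij
  by_cases hj : j < Fintype.card m
  · have hi : i < Fintype.card m := lt_of_le_of_lt hij hj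
    rw [eig, eig, dif_pos ⟨hM.1, hj⟩, dif_pos ⟨hM.1, hi⟩]
    exact hM.1.eigenvalues₀_antitone hij
  · have : eig M j = 0 := dif_neg fun h => hj h.2
    rw [this]
    exact eig_nonneg hM i

theorem tail_succ (M : Matrix m m ℝ) {t : ℕ} (ht : t < Fintype.card m) :
    tail M t = eig M t + tail M (t + 1) := by
  unfold tail
  exact Finset.sum_eq_sum_Ico_succ_bot ht _

theorem existsUnique_isThreshold {M : Matrix m m ℝ} (hM : M.PosSemidef) {k : ℕ} (hk : 1 ≤ k)
    (hkm : k ≤ Fintype.card m) : ∃! t, IsThreshold k M t := by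
  have hpos : ∀ t, t < k → (0 : ℝ) < (k : ℝ) - t := fun t ht => by
    have : (t : ℝ) < k := by exact_mod_cast ht
    linarith
  have hex : ∃ t, t < k ∧ eig M t ≤ tail M t / ((k : ℝ) - t) := by
    refine ⟨k - 1, by omega, ?_⟩
    have h1 : ((k : ℝ) - (k - 1 : ℕ)) = 1 := by
      rw [Nat.cast_sub hk]; simp
    rw [h1, div_one, tail_succ M (by omega : k - 1 < Fintype.card m)]
    have : 0 ≤ tail M (k - 1 + 1) := Finset.sum_nonneg fun i _ => eig_nonneg hM i
    linarith
  classical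
  have hfind : IsThreshold k M (Nat.find hex) := by
    refine ⟨(Nat.find_spec hex).1, ?_, (Nat.find_spec hex).2⟩
    intro s hs
    have hlt := (Nat.find_spec hex).1
    have hmin := Nat.find_min hex (m := s) (by omega)
    rw [hs] at hlt ⊢
    have h2 : tail M s / ((k : ℝ) - s) < eig M s := by
      by_contra hc
      exact hmin ⟨by omega, not_lt.mp hc⟩
    rw [div_lt_iff₀ (hpos s (by omega)), tail_succ M (by omega : s < Fintype.card m)] at h2
    rw [div_lt_iff₀ (hpos _ hlt)]
    push_cast
    linarith
  have key : ∀ t t', IsThreshold k M t → IsThreshold k M t' → ¬ t < t' := by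
    intro t t' h h' htt
    obtain ⟨n, rfl⟩ := Nat.exists_eq_add_of_lt htt
    have hb := h'.2.1 (t + n) rfl
    have hlt := h'.1
    have hlt' := h'.1
    rw [div_lt_iff₀ (hpos _ hlt)] at hb
    have down : ∀ j, j ≤ n →
        tail M (n - j + t) < eig M (n - j + t) * ((k : ℝ) - (n - j + t : ℕ)) := by
      intro j
      induction j with
      | zero =>
        intro _
        rw [tail_succ M (by omega)]
        rw [Nat.sub_zero, add_comm n t]
        push_cast at hb ⊢
        linarith
      | succ j ih =>
        intro hj
        have ih := ih (by omega)
        have e : n - j + t = (n - (j + 1) + t) + 1 := by omega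
        rw [e] at ih
        rw [tail_succ M (by omega : n - (j + 1) + t < Fintype.card m)]
        have ha := eig_antitone hM (Nat.le_succ (n - (j + 1) + t))
        have hp := hpos (n - (j + 1) + t + 1) (by omega)
        have := mul_le_mul_of_nonneg_right ha hp.le
        rw [Nat.succ_eq_add_one] at this
        push_cast at ih this ⊢
        linarith
    have hd := down n le_rfl
    rw [Nat.sub_self, zero_add, ← div_lt_iff₀ (hpos _ h.1)] at hd
    exact absurd h.2.2 (not_le.mpr hd)
  exact ⟨_, hfind, fun t ht => le_antisymm (not_lt.mp (key _ _ hfind ht)) (not_lt.mp (key _ _ ht hfind))⟩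

theorem isThreshold_threshold {M : Matrix m m ℝ} (hM : M.PosSemidef) {k : ℕ} (hk : 1 ≤ k)
    (hkm : k ≤ Fintype.card m) : IsThreshold k M (threshold k M) :=
  Nat.sInf_mem (existsUnique_isThreshold hM hk hkm).exists

end KyFanDual

/-!
Write `Σ_q = A diag(q) Aᵀ`, and let `q` range over the probability vectors. Both inequalities come
from the identity `2 h_k(Σ) = inf {‖X⁻¹‖_(k) + tr(X Σ) | X ≻ 0}`.

The bound `≤` is proved in the scaled form `hFun_sq_le_kyFan_inv`. In an eigenbasis `u_i` of `Σ`
one has `h_k(Σ) = ∑ √(v_i σ_i)` for weights `0 ≤ v_i ≤ 1` with `∑ v_i ≤ k` (`exists_weights`). By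
the Ky Fan inequality `‖X⁻¹‖_(k) ≥ ∑ v_i u_iᵀ X⁻¹ u_i`, and each summand is bounded below by the
supremum of the functions `2 wᵀ u_i - wᵀ X w` at a suitable multiple `w` of `u_i`. As
`tr(X Σ_q) = ∑ q_e a_eᵀ X a_e ≤ 1` for feasible `X`, this is weak duality. The bound `≥` is
`exists_kyFan_inv_add_trace_le`: let `X⁻¹` have the eigenvectors of `Σ` and the eigenvalues
`√σ₁, …, √σ_t, c, c, …`, where `c² = (∑_{i > t} σ_i) / (k - t)`.

The primal minimum is attained because `X ↦ ‖X⁻¹‖_(k)` is lower semicontinuous and its sublevel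
sets in the feasible region are compact, by the rank condition. Let `μ` be the minimum. Scaling `X`
shows that `‖X⁻¹‖_(k) + max_e a_eᵀ X a_e ≥ 2 √μ` for all `X ≻ 0`. The function
`‖X⁻¹‖_(k) + tr(X Σ_q)` is convex in `X` and affine in `q`, and `q` ranges over a compact convex
set, so Sion's minimax argument yields a single `q` with `‖X⁻¹‖_(k) + tr(X Σ_q) ≥ 2 √μ` for
all `X ≻ 0`. Taking the infimum over `X` gives `h_k(Σ_q) ≥ √μ`, and `q` is dual optimal.
-/

namespace KyFanDual

open Matrix

variable {m : Type*} [Fintype m] [DecidableEq m]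

set_option linter.unusedSectionVars false

/-! ### Orthonormal bases and quadratic forms -/

theorem dotProduct_basis_self {n : ℕ} (u : OrthonormalBasis (Fin n) ℝ (EuclideanSpace ℝ m))
    (i : Fin n) : (u i).ofLp ⬝ᵥ (u i).ofLp = 1 := by
  have h := u.inner_eq_one i
  rwa [EuclideanSpace.inner_eq_star_dotProduct, star_trivial] at h

theorem sum_dotProduct_smul_basis {n : ℕ}
    (u : OrthonormalBasis (Fin n) ℝ (EuclideanSpace ℝ m)) (x : m → ℝ) :
    ∑ i, ((u i).ofLp ⬝ᵥ x) • (u i).ofLp = x := by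
  have h := congrArg WithLp.ofLp (u.sum_repr' (WithLp.toLp 2 x))
  simpa [EuclideanSpace.inner_eq_star_dotProduct, dotProduct_comm] using h

/-- Expansion of the quadratic form of a matrix in an orthonormal basis of eigenvectors. -/
theorem quadForm_eq_sum {n : ℕ} (u : OrthonormalBasis (Fin n) ℝ (EuclideanSpace ℝ m))
    {Y : Matrix m m ℝ} {y : Fin n → ℝ} (hY : ∀ i, Y *ᵥ (u i).ofLp = y i • (u i).ofLp)
    (x : m → ℝ) : x ⬝ᵥ Y *ᵥ x = ∑ i, y i * ((u i).ofLp ⬝ᵥ x) ^ 2 := by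
  conv_lhs => rw [← sum_dotProduct_smul_basis u x, mulVec_sum]
  rw [sum_dotProduct_smul_basis u x, dotProduct_sum]
  refine Finset.sum_congr rfl fun i _ => ?_
  rw [mulVec_smul, hY, dotProduct_smul, dotProduct_smul, dotProduct_comm x]
  simp only [smul_eq_mul]
  ring

theorem sum_sq_dotProduct_basis {n : ℕ}
    (u : OrthonormalBasis (Fin n) ℝ (EuclideanSpace ℝ m)) (x : m → ℝ) :
    ∑ i, ((u i).ofLp ⬝ᵥ x) ^ 2 = x ⬝ᵥ x := by
  have h := quadForm_eq_sum u (Y := 1) (y := fun _ => 1) (by simp) x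
  simpa using h.symm

theorem trace_eq_sum_basis {n : ℕ} (u : OrthonormalBasis (Fin n) ℝ (EuclideanSpace ℝ m))
    (M : Matrix m m ℝ) : M.trace = ∑ i, (u i).ofLp ⬝ᵥ M *ᵥ (u i).ofLp := by
  have h1 : ∑ i, vecMulVec (u i).ofLp (u i).ofLp = (1 : Matrix m m ℝ) := by
    refine Matrix.ext_of_mulVec_single fun j => ?_
    rw [sum_mulVec, one_mulVec]
    conv_rhs => rw [← sum_dotProduct_smul_basis u (Pi.single j 1)]
    refine Finset.sum_congr rfl fun i _ => ?_
    rw [vecMulVec_mulVec]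
    simp
  conv_lhs => rw [← mul_one M, ← h1, Finset.mul_sum, trace_sum]
  refine Finset.sum_congr rfl fun i _ => ?_
  rw [mul_vecMulVec, trace_vecMulVec, dotProduct_comm]

/-- An orthonormal basis of eigenvectors, ordered as `eig`. -/
theorem exists_eigenbasis {M : Matrix m m ℝ} (hM : M.IsHermitian) :
    ∃ u : OrthonormalBasis (Fin (Fintype.card m)) ℝ (EuclideanSpace ℝ m),
      ∀ i, M *ᵥ (u i).ofLp = eig M i • (u i).ofLp := by
  refine ⟨hM.eigenvectorBasis.reindex (Fintype.equivOfCardEq (Fintype.card_fin _)).symm,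
    fun i => ?_⟩
  have h := hM.mulVec_eigenvectorBasis ((Fintype.equivOfCardEq (Fintype.card_fin _)) i)
  rw [eig, dif_pos ⟨hM, i.2⟩]
  simpa [Matrix.IsHermitian.eigenvalues] using h

/-! ### The Ky Fan inequality -/

/-- A weighted sum with weights in `[0, 1]` of total at most `k` is at most the sum of the `t`
entries above a level `c`, plus `k - t` times `c`. -/
theorem sum_mul_weights_le {n t : ℕ} {k c : ℝ} (htn : t ≤ n) (hc : 0 ≤ c) {y p : Fin n → ℝ}
    {z : ℕ → ℝ} (hz : ∀ i : Fin n, (i : ℕ) < t → y i = z i)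
    (hy₁ : ∀ i : Fin n, (i : ℕ) < t → c ≤ y i) (hy₂ : ∀ i : Fin n, t ≤ (i : ℕ) → y i ≤ c)
    (hp₀ : ∀ i, 0 ≤ p i) (hp₁ : ∀ i, p i ≤ 1) (hp : ∑ i, p i ≤ k) :
    ∑ i, y i * p i ≤ ∑ i ∈ Finset.range t, z i + (k - t) * c := by
  have hle : ∀ i : Fin n, y i * p i ≤ c * p i + if (i : ℕ) < t then z i - c else 0 := by
    intro i
    split_ifs with h
    · rw [← hz i h]
      nlinarith [mul_nonneg (sub_nonneg.2 (hy₁ i h)) (sub_nonneg.2 (hp₁ i))]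
    · nlinarith [mul_nonneg (sub_nonneg.2 (hy₂ i (not_lt.1 h))) (hp₀ i)]
  have hs : ∑ i : Fin n, (if (i : ℕ) < t then z i - c else 0) =
      ∑ i ∈ Finset.range t, z i - t * c := by
    rw [Fin.sum_univ_eq_sum_range (fun i => if i < t then z i - c else 0) n,
      ← Finset.sum_filter]
    have : (Finset.range n).filter (· < t) = Finset.range t := by
      ext i; simp only [Finset.mem_filter, Finset.mem_range]; omega
    rw [this, Finset.sum_sub_distrib]
    simp
  calc ∑ i, y i * p i ≤ ∑ i : Fin n, (c * p i + if (i : ℕ) < t then z i - c else 0) :=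
        Finset.sum_le_sum fun i _ => hle i
    _ = c * ∑ i, p i + (∑ i ∈ Finset.range t, z i - t * c) := by
        rw [Finset.sum_add_distrib, hs, Finset.mul_sum]
    _ ≤ _ := by nlinarith [mul_le_mul_of_nonneg_left hp hc]

/-- The Ky Fan inequality: the Ky Fan norm bounds every weighted sum of diagonal entries in an
orthonormal basis, if the weights lie in `[0, 1]` and sum to at most `k`. -/
theorem sum_weights_quadForm_le_kyFan {Y : Matrix m m ℝ} (hY : Y.PosSemidef) {k : ℕ}
    (hkm : k ≤ Fintype.card m) {n : ℕ}
    (u : OrthonormalBasis (Fin n) ℝ (EuclideanSpace ℝ m)) {v : Fin n → ℝ}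
    (hv₀ : ∀ i, 0 ≤ v i) (hv₁ : ∀ i, v i ≤ 1) (hv : ∑ i, v i ≤ k) :
    ∑ i, v i * ((u i).ofLp ⬝ᵥ Y *ᵥ (u i).ofLp) ≤ kyFan k Y := by
  obtain ⟨w, hw⟩ := exists_eigenbasis hY.1
  have hswap : ∑ i, v i * ((u i).ofLp ⬝ᵥ Y *ᵥ (u i).ofLp) =
      ∑ j : Fin (Fintype.card m), eig Y j * ∑ i, v i * ((w j).ofLp ⬝ᵥ (u i).ofLp) ^ 2 := by
    simp_rw [quadForm_eq_sum w (y := fun j => eig Y j) hw, Finset.mul_sum]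
    rw [Finset.sum_comm]
    refine Finset.sum_congr rfl fun j _ => Finset.sum_congr rfl fun i _ => by ring
  rw [hswap]
  have h := sum_mul_weights_le (n := Fintype.card m) (t := k) (k := k) (c := eig Y (k - 1))
    (y := fun j => eig Y j) (z := eig Y)
    (p := fun j => ∑ i, v i * ((w j).ofLp ⬝ᵥ (u i).ofLp) ^ 2) hkm (eig_nonneg hY _)
    (fun _ _ => rfl) (fun i hi => eig_antitone hY (by omega))
    (fun i hi => eig_antitone hY (by omega))
    (fun j => Finset.sum_nonneg fun i _ => mul_nonneg (hv₀ i) (sq_nonneg _)) ?_ ?_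
  · simpa [kyFan] using h
  · intro j
    calc ∑ i, v i * ((w j).ofLp ⬝ᵥ (u i).ofLp) ^ 2 ≤ ∑ i, ((u i).ofLp ⬝ᵥ (w j).ofLp) ^ 2 :=
          Finset.sum_le_sum fun i _ => by
            rw [dotProduct_comm]
            exact mul_le_of_le_one_left (sq_nonneg _) (hv₁ i)
      _ = 1 := by rw [sum_sq_dotProduct_basis, dotProduct_basis_self]
  · rw [Finset.sum_comm]
    simp_rw [← Finset.mul_sum, sum_sq_dotProduct_basis, dotProduct_basis_self, mul_one]
    exact hv

/-- The Ky Fan norm is the sum of the diagonal entries at the `k` top eigenvectors. -/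
theorem kyFan_eq_sum_quadForm {Y : Matrix m m ℝ} {k : ℕ} (hkm : k ≤ Fintype.card m)
    {w : OrthonormalBasis (Fin (Fintype.card m)) ℝ (EuclideanSpace ℝ m)}
    (hw : ∀ i, Y *ᵥ (w i).ofLp = eig Y i • (w i).ofLp) :
    kyFan k Y = ∑ i : Fin (Fintype.card m), (if (i : ℕ) < k then (1 : ℝ) else 0) *
      ((w i).ofLp ⬝ᵥ Y *ᵥ (w i).ofLp) := by
  simp_rw [hw, dotProduct_smul, dotProduct_basis_self, smul_eq_mul, mul_one, ite_mul, one_mul,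
    zero_mul]
  rw [Fin.sum_univ_eq_sum_range (fun i => if i < k then eig Y i else 0), ← Finset.sum_filter,
    kyFan]
  congr 1
  ext i; simp only [Finset.mem_filter, Finset.mem_range]; omega

theorem sum_indicator_lt {n k : ℕ} (hkn : k ≤ n) :
    ∑ i : Fin n, (if (i : ℕ) < k then (1 : ℝ) else 0) = k := by
  rw [Fin.sum_univ_eq_sum_range (fun i => if i < k then (1 : ℝ) else 0), ← Finset.sum_filter]
  have : (Finset.range n).filter (· < k) = Finset.range k := by
    ext i; simp only [Finset.mem_filter, Finset.mem_range]; omega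
  simp [this]

/-- A bound for the Ky Fan norm of a matrix with eigenvalues `y i`, of which the first `t` are at
least `c` and the others at most `c`. It is an equality if the others equal `c` and `t ≤ k`. -/
theorem kyFan_le_of_eigenbasis {Y : Matrix m m ℝ} (hY : Y.IsHermitian) {k : ℕ}
    (hkm : k ≤ Fintype.card m) {n t : ℕ}
    (u : OrthonormalBasis (Fin n) ℝ (EuclideanSpace ℝ m)) {y : Fin n → ℝ}
    (hu : ∀ i, Y *ᵥ (u i).ofLp = y i • (u i).ofLp) {c : ℝ} (hc : 0 ≤ c) (htn : t ≤ n)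
    {z : ℕ → ℝ} (hz : ∀ i : Fin n, (i : ℕ) < t → y i = z i)
    (hy₁ : ∀ i : Fin n, (i : ℕ) < t → c ≤ y i) (hy₂ : ∀ i : Fin n, t ≤ (i : ℕ) → y i ≤ c) :
    kyFan k Y ≤ ∑ i ∈ Finset.range t, z i + (k - t) * c := by
  obtain ⟨w, hw⟩ := exists_eigenbasis hY
  set b : Fin (Fintype.card m) → ℝ := fun i => if (i : ℕ) < k then (1 : ℝ) else 0 with hb
  have hb₀ : ∀ i, 0 ≤ b i := fun i => by simp only [hb]; split_ifs <;> norm_num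
  have hb₁ : ∀ i, b i ≤ 1 := fun i => by simp only [hb]; split_ifs <;> norm_num
  have hswap : kyFan k Y = ∑ i, y i * ∑ j, b j * ((u i).ofLp ⬝ᵥ (w j).ofLp) ^ 2 := by
    rw [kyFan_eq_sum_quadForm hkm hw]
    simp_rw [quadForm_eq_sum u hu, Finset.mul_sum]
    rw [Finset.sum_comm]
    refine Finset.sum_congr rfl fun j _ => Finset.sum_congr rfl fun i _ => by
      simp only [hb]; ring
  rw [hswap]
  refine sum_mul_weights_le htn hc hz hy₁ hy₂
    (fun i => Finset.sum_nonneg fun j _ => mul_nonneg (hb₀ j) (sq_nonneg _)) ?_ ?_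
  · intro i
    calc ∑ j, b j * ((u i).ofLp ⬝ᵥ (w j).ofLp) ^ 2 ≤ ∑ j, ((w j).ofLp ⬝ᵥ (u i).ofLp) ^ 2 :=
          Finset.sum_le_sum fun j _ => by
            rw [dotProduct_comm]
            exact mul_le_of_le_one_left (sq_nonneg _) (hb₁ j)
      _ = 1 := by rw [sum_sq_dotProduct_basis, dotProduct_basis_self]
  · rw [Finset.sum_comm]
    simp_rw [← Finset.mul_sum, sum_sq_dotProduct_basis, dotProduct_basis_self, mul_one]
    exact (sum_indicator_lt hkm).le

theorem quadForm_le_kyFan_mul {Y : Matrix m m ℝ} (hY : Y.PosSemidef) {k : ℕ} (hk : 1 ≤ k)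
    (x : m → ℝ) : x ⬝ᵥ Y *ᵥ x ≤ kyFan k Y * (x ⬝ᵥ x) := by
  obtain ⟨w, hw⟩ := exists_eigenbasis hY.1
  rw [quadForm_eq_sum w (y := fun j => eig Y j) hw, ← sum_sq_dotProduct_basis w x,
    Finset.mul_sum]
  refine Finset.sum_le_sum fun i _ => mul_le_mul_of_nonneg_right ?_ (sq_nonneg _)
  exact (eig_antitone hY (Nat.zero_le _)).trans
    (Finset.single_le_sum (fun j _ => eig_nonneg hY j) (Finset.mem_range.2 hk))

/-! ### The Ky Fan norm of the inverse as a supremum of affine functions -/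

theorem two_mul_dotProduct_sub_le {X : Matrix m m ℝ} (hX : X.PosDef) (v w : m → ℝ) :
    2 * (w ⬝ᵥ v) - w ⬝ᵥ X *ᵥ w ≤ v ⬝ᵥ X⁻¹ *ᵥ v := by
  set z := X⁻¹ *ᵥ v with hz
  have hXz : X *ᵥ z = v := by
    rw [hz, mulVec_mulVec, mul_nonsing_inv _ hX.det_pos.ne'.isUnit, one_mulVec]
  have h := hX.posSemidef.dotProduct_mulVec_nonneg (w - z)
  have hsymm : z ⬝ᵥ X *ᵥ w = w ⬝ᵥ v := by
    rw [dotProduct_mulVec, ← mulVec_transpose, dotProduct_comm]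
    have : Xᵀ = X := by simpa using hX.1.eq
    rw [this, hXz]
  simp only [star_trivial, mulVec_sub, sub_dotProduct, dotProduct_sub, hXz, hsymm] at h
  rw [dotProduct_comm v z]
  linarith

theorem quadForm_inv_eq {X : Matrix m m ℝ} (hX : X.PosDef) (v : m → ℝ) :
    v ⬝ᵥ X⁻¹ *ᵥ v = 2 * ((X⁻¹ *ᵥ v) ⬝ᵥ v) - (X⁻¹ *ᵥ v) ⬝ᵥ X *ᵥ (X⁻¹ *ᵥ v) := by
  rw [mulVec_mulVec, mul_nonsing_inv _ hX.det_pos.ne'.isUnit, one_mulVec, dotProduct_comm v]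
  ring

/-- At each positive definite `X₀`, the function `X ↦ ‖X⁻¹‖_(k)` is touched from below by an
affine function (built from the `k` top eigenvectors of `X₀⁻¹`). -/
theorem exists_affine_minorant {X₀ : Matrix m m ℝ} (hX₀ : X₀.PosDef) {k : ℕ}
    (hkm : k ≤ Fintype.card m) :
    ∃ (a : ℝ) (g : Matrix m m ℝ →ₗ[ℝ] ℝ), Continuous g ∧ kyFan k X₀⁻¹ = a + g X₀ ∧
      ∀ X : Matrix m m ℝ, X.PosDef → a + g X ≤ kyFan k X⁻¹ := by
  obtain ⟨u, hu⟩ := exists_eigenbasis hX₀.inv.1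
  set b : Fin (Fintype.card m) → ℝ := fun i => if (i : ℕ) < k then (1 : ℝ) else 0 with hb
  have hb₀ : ∀ i, 0 ≤ b i := fun i => by simp only [hb]; split_ifs <;> norm_num
  have hb₁ : ∀ i, b i ≤ 1 := fun i => by simp only [hb]; split_ifs <;> norm_num
  set w : Fin (Fintype.card m) → m → ℝ := fun i => X₀⁻¹ *ᵥ (u i).ofLp with hw
  let g : Matrix m m ℝ →ₗ[ℝ] ℝ :=
    { toFun := fun X => ∑ i, b i * -(w i ⬝ᵥ X *ᵥ w i)
      map_add' := fun X Y => by
        simp only [add_mulVec, dotProduct_add, neg_add, mul_add, Finset.sum_add_distrib]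
      map_smul' := fun r X => by
        simp only [smul_mulVec, dotProduct_smul, smul_eq_mul, RingHom.id_apply, Finset.mul_sum]
        exact Finset.sum_congr rfl fun i _ => by ring }
  refine ⟨∑ i, b i * (2 * (w i ⬝ᵥ (u i).ofLp)), g, ?_, ?_, fun X hX => ?_⟩
  · change Continuous fun X : Matrix m m ℝ => ∑ i, b i * -(w i ⬝ᵥ X *ᵥ w i)
    fun_prop
  · rw [kyFan_eq_sum_quadForm hkm hu]
    change _ = _ + ∑ i, b i * -(w i ⬝ᵥ X₀ *ᵥ w i)
    rw [← Finset.sum_add_distrib]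
    refine Finset.sum_congr rfl fun i _ => ?_
    rw [quadForm_inv_eq hX₀]
    simp only [hb, hw]; ring
  · refine le_trans ?_ (sum_weights_quadForm_le_kyFan hX.inv.posSemidef hkm u hb₀ hb₁
      (sum_indicator_lt hkm).le)
    change _ + ∑ i, b i * -(w i ⬝ᵥ X *ᵥ w i) ≤ _
    rw [← Finset.sum_add_distrib]
    refine Finset.sum_le_sum fun i _ => ?_
    rw [← mul_add]
    refine mul_le_mul_of_nonneg_left ?_ (hb₀ i)
    have := two_mul_dotProduct_sub_le hX (u i).ofLp (w i)
    linarith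

theorem convex_posDef : Convex ℝ {X : Matrix m m ℝ | X.PosDef} := by
  rw [convex_iff_forall_pos]
  intro X hX Y hY a b ha hb _
  exact (Matrix.PosDef.smul hX ha).add (Matrix.PosDef.smul hY hb)

theorem convexOn_kyFan_inv {k : ℕ} (hkm : k ≤ Fintype.card m) :
    ConvexOn ℝ {X : Matrix m m ℝ | X.PosDef} fun X => kyFan k X⁻¹ := by
  refine ⟨convex_posDef, fun X hX Y hY a b ha hb hab => ?_⟩
  obtain ⟨r, g, -, heq, hle⟩ := exists_affine_minorant (convex_posDef hX hY ha hb hab) hkm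
  simp only [heq, map_add, map_smul, smul_eq_mul]
  have h₁ := mul_le_mul_of_nonneg_left (hle X hX) ha
  have h₂ := mul_le_mul_of_nonneg_left (hle Y hY) hb
  have : r = a * r + b * r := by rw [← add_mul, hab, one_mul]
  linarith

theorem lowerSemicontinuousOn_kyFan_inv {k : ℕ} (hkm : k ≤ Fintype.card m) :
    LowerSemicontinuousOn (fun X : Matrix m m ℝ => kyFan k X⁻¹) {X | X.PosDef} := by
  intro X₀ hX₀ y hy
  obtain ⟨r, g, hg, heq, hle⟩ := exists_affine_minorant hX₀ hkm
  have hcont : Continuous fun X => r + g X := continuous_const.add hg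
  simp only [heq] at hy
  filter_upwards [mem_nhdsWithin_of_mem_nhds (hcont.continuousAt.eventually (lt_mem_nhds hy)),
    self_mem_nhdsWithin] with X hX hXp
  exact hX.trans_le (hle X hXp)

/-! ### The function `h_k` and the trace pairing -/

/-- The common value `√((∑_{i > t} σ_i) / (k - t))` that replaces `√σ_i` for `i > t` in the
definition of `h_k`, where `t` is the threshold. -/
noncomputable def level (k : ℕ) (M : Matrix m m ℝ) : ℝ :=
  √(tail M (threshold k M) / ((k : ℝ) - threshold k M))

/-- The numbers `√σ₁, …, √σ_t, c, c, …`, where `t` is the threshold and `c` the level. They are the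
eigenvalues of the inverse of the matrix `X` that minimizes `‖X⁻¹‖_(k) + tr(X M)` (when `c > 0`). -/
noncomputable def flatSqrt (k : ℕ) (M : Matrix m m ℝ) (i : ℕ) : ℝ :=
  if i < threshold k M then √(eig M i) else level k M

theorem level_nonneg (k : ℕ) (M : Matrix m m ℝ) : 0 ≤ level k M := Real.sqrt_nonneg _

theorem tail_nonneg {M : Matrix m m ℝ} (hM : M.PosSemidef) (t : ℕ) : 0 ≤ tail M t :=
  Finset.sum_nonneg fun i _ => eig_nonneg hM i

section Threshold

variable {M : Matrix m m ℝ} (hM : M.PosSemidef) {k : ℕ} (hk : 1 ≤ k)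
  (hkm : k ≤ Fintype.card m)

include hM hk hkm

theorem threshold_lt : threshold k M < k := (isThreshold_threshold hM hk hkm).1

theorem sub_threshold_pos : (0 : ℝ) < (k : ℝ) - threshold k M := by
  have : (threshold k M : ℝ) < k := by exact_mod_cast threshold_lt hM hk hkm
  linarith

theorem mul_level_sq : ((k : ℝ) - threshold k M) * level k M ^ 2 = tail M (threshold k M) := by
  have h := sub_threshold_pos hM hk hkm
  rw [level, Real.sq_sqrt (div_nonneg (tail_nonneg hM _) h.le)]
  field_simp

theorem hFun_eq : hFun k M = ∑ i ∈ Finset.range (threshold k M), √(eig M i) +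
    ((k : ℝ) - threshold k M) * level k M := by
  have h := sub_threshold_pos hM hk hkm
  rw [hFun, ← mul_level_sq hM hk hkm, Real.sqrt_mul h.le, Real.sqrt_sq (level_nonneg k M),
    ← mul_assoc, Real.mul_self_sqrt h.le]

theorem eig_le_level_sq {i : ℕ} (hi : threshold k M ≤ i) : eig M i ≤ level k M ^ 2 := by
  have h := sub_threshold_pos hM hk hkm
  rw [level, Real.sq_sqrt (div_nonneg (tail_nonneg hM _) h.le)]
  exact (eig_antitone hM hi).trans (isThreshold_threshold hM hk hkm).2.2

theorem level_le_sqrt_eig {i : ℕ} (hi : i < threshold k M) : level k M ≤ √(eig M i) := by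
  refine Real.sqrt_le_sqrt ?_
  obtain ⟨s, hs⟩ := Nat.exists_eq_add_one_of_ne_zero (Nat.ne_zero_of_lt hi)
  exact ((isThreshold_threshold hM hk hkm).2.1 s hs).le.trans (eig_antitone hM (by omega))

/-- Split of a sum over all eigenvalues at the threshold. -/
theorem sum_split_threshold (f : ℕ → ℝ) :
    ∑ i : Fin (Fintype.card m), f i = ∑ i ∈ Finset.range (threshold k M), f i +
      ∑ i ∈ Finset.Ico (threshold k M) (Fintype.card m), f i := by
  rw [Fin.sum_univ_eq_sum_range, Finset.sum_range_add_sum_Ico _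
    ((threshold_lt hM hk hkm).le.trans hkm)]

/-- Weights `v i` with `∑ v_i √(σ_i / v_i) = h_k`: they are the eigenvalues of the matrix `V`,
`0 ⪯ V ⪯ 1`, `tr V ≤ k`, that has the largest fidelity with `M`. -/
theorem exists_weights : ∃ v : ℕ → ℝ, (∀ i, 0 ≤ v i) ∧ (∀ i, v i ≤ 1) ∧
    ∑ i : Fin (Fintype.card m), v i ≤ k ∧
    ∑ i : Fin (Fintype.card m), v i * flatSqrt k M i = hFun k M ∧
    ∀ i, v i * flatSqrt k M i ^ 2 ≤ eig M i := by
  have hlt := sub_threshold_pos hM hk hkm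
  have hL := mul_level_sq hM hk hkm
  set t := threshold k M with ht
  set c := level k M with hc
  have hc0 : 0 ≤ c := level_nonneg k M
  -- If `c = 0`, all `σ_i` with `i > t` vanish and division by zero gives these the weight `0`.
  refine ⟨fun i => if i < t then 1 else eig M i / c ^ 2, fun i => ?_, fun i => ?_, ?_, ?_,
    fun i => ?_⟩
  · dsimp only
    split_ifs
    · exact zero_le_one
    · exact div_nonneg (eig_nonneg hM i) (sq_nonneg c)
  · dsimp only
    split_ifs with h
    · exact le_rfl
    · exact div_le_one_of_le₀ (eig_le_level_sq hM hk hkm (not_lt.1 h)) (sq_nonneg c)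
  · rw [sum_split_threshold hM hk hkm (fun i => if i < t then (1 : ℝ) else eig M i / c ^ 2),
      Finset.sum_congr rfl (fun i hi => if_pos (Finset.mem_range.1 hi)),
      Finset.sum_congr rfl (fun i hi => if_neg (not_lt.2 (Finset.mem_Ico.1 hi).1)),
      ← Finset.sum_div]
    change _ + tail M t / c ^ 2 ≤ _
    have : tail M t / c ^ 2 ≤ k - t := div_le_of_le_mul₀ (sq_nonneg c) hlt.le hL.ge
    simp only [Finset.sum_const, Finset.card_range, nsmul_eq_mul, mul_one]
    linarith
  · rw [hFun_eq hM hk hkm, sum_split_threshold hM hk hkm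
      (fun i => (if i < t then (1 : ℝ) else eig M i / c ^ 2) * flatSqrt k M i), ← ht, ← hc]
    congr 1
    · refine Finset.sum_congr rfl fun i hi => ?_
      rw [if_pos (Finset.mem_range.1 hi), flatSqrt, if_pos (Finset.mem_range.1 hi), one_mul]
    · have : ∀ i ∈ Finset.Ico t (Fintype.card m),
          (if i < t then (1 : ℝ) else eig M i / c ^ 2) * flatSqrt k M i =
            eig M i * (c / c ^ 2) := fun i hi => by
        have h := not_lt.2 (Finset.mem_Ico.1 hi).1
        rw [if_neg h, flatSqrt, if_neg h]
        ring
      rw [Finset.sum_congr rfl this, ← Finset.sum_mul]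
      change tail M t * (c / c ^ 2) = _
      rw [← hL]
      rcases hc0.eq_or_lt with h | h
      · rw [← h]; simp
      · field_simp
  · dsimp only [flatSqrt]
    split_ifs with h
    · rw [one_mul, Real.sq_sqrt (eig_nonneg hM i)]
    · rcases hc0.eq_or_lt with h' | h'
      · rw [← hc, ← h']; simpa using eig_nonneg hM i
      · rw [← hc, div_mul_cancel₀ _ (by positivity)]

/-- Weak duality: `h_k(M)² ≤ ‖X⁻¹‖_(k)` if `tr(X M) ≤ 1`. -/
theorem hFun_sq_le_kyFan_inv {X : Matrix m m ℝ} (hX : X.PosDef) (htr : (X * M).trace ≤ 1) :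
    hFun k M ^ 2 ≤ kyFan k X⁻¹ := by
  obtain ⟨u, hu⟩ := exists_eigenbasis hM.1
  obtain ⟨v, hv₀, hv₁, hv, hsum, hsq⟩ := exists_weights hM hk hkm
  set h := hFun k M
  set y := flatSqrt k M
  have htr' : (X * M).trace =
      ∑ i : Fin (Fintype.card m), eig M i * ((u i).ofLp ⬝ᵥ X *ᵥ (u i).ofLp) := by
    rw [trace_eq_sum_basis u]
    refine Finset.sum_congr rfl fun i _ => ?_
    rw [← mulVec_mulVec, hu, mulVec_smul, dotProduct_smul, smul_eq_mul]
  -- The minorant is taken at `w = (h * y i) • u i`, which is `X⁻¹ *ᵥ u i` for the optimal `X`.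
  have key : ∀ i : Fin (Fintype.card m),
      2 * h * (v i * y i) - h ^ 2 * (eig M i * ((u i).ofLp ⬝ᵥ X *ᵥ (u i).ofLp)) ≤
        v i * ((u i).ofLp ⬝ᵥ X⁻¹ *ᵥ (u i).ofLp) := by
    intro i
    have h1 := two_mul_dotProduct_sub_le hX (u i).ofLp ((h * y i) • (u i).ofLp)
    simp only [smul_dotProduct, mulVec_smul, dotProduct_smul, smul_eq_mul,
      dotProduct_basis_self] at h1
    have h2 := mul_le_mul_of_nonneg_left h1 (hv₀ i)
    have hq : 0 ≤ (u i).ofLp ⬝ᵥ X *ᵥ (u i).ofLp := by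
      simpa using hX.posSemidef.dotProduct_mulVec_nonneg (u i).ofLp
    have h3 := mul_le_mul_of_nonneg_left (mul_le_mul_of_nonneg_right (hsq i) hq) (sq_nonneg h)
    linarith
  calc h ^ 2 = 2 * h * h - h ^ 2 * 1 := by ring
    _ ≤ 2 * h * h - h ^ 2 * (X * M).trace :=
        sub_le_sub_left (mul_le_mul_of_nonneg_left htr (sq_nonneg h)) _
    _ = ∑ i : Fin (Fintype.card m), (2 * h * (v i * y i) -
          h ^ 2 * (eig M i * ((u i).ofLp ⬝ᵥ X *ᵥ (u i).ofLp))) := by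
        rw [Finset.sum_sub_distrib, ← Finset.mul_sum, ← Finset.mul_sum, hsum, htr']
    _ ≤ ∑ i : Fin (Fintype.card m), v i * ((u i).ofLp ⬝ᵥ X⁻¹ *ᵥ (u i).ofLp) :=
        Finset.sum_le_sum fun i _ => key i
    _ ≤ kyFan k X⁻¹ := sum_weights_quadForm_le_kyFan hX.inv.posSemidef hkm u
        (fun i => hv₀ i) (fun i => hv₁ i) hv

end Threshold

/-- A positive definite matrix with prescribed eigenvectors and eigenvalues. -/
theorem exists_posDef_of_eigenbasis {n : ℕ} (u : OrthonormalBasis (Fin n) ℝ (EuclideanSpace ℝ m))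
    {d : Fin n → ℝ} (hd : ∀ i, 0 < d i) :
    ∃ X : Matrix m m ℝ, X.PosDef ∧ ∀ i, X *ᵥ (u i).ofLp = d i • (u i).ofLp := by
  have hu : ∀ j, (∑ i, d i • vecMulVec (u i).ofLp (u i).ofLp) *ᵥ (u j).ofLp =
      d j • (u j).ofLp := by
    intro j
    rw [sum_mulVec, Finset.sum_eq_single j]
    · rw [smul_mulVec, vecMulVec_mulVec, dotProduct_basis_self]
      simp
    · intro i _ hij
      have h := u.inner_eq_zero hij
      rw [EuclideanSpace.inner_eq_star_dotProduct, star_trivial, dotProduct_comm] at h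
      rw [smul_mulVec, vecMulVec_mulVec, h]
      simp
    · simp
  refine ⟨_, PosDef.of_dotProduct_mulVec_pos ?_ fun x hx => ?_, hu⟩
  · rw [IsHermitian, conjTranspose_sum]
    refine Finset.sum_congr rfl fun i _ => ?_
    rw [conjTranspose_smul, conjTranspose_vecMulVec]
    simp
  · rw [star_trivial, quadForm_eq_sum u hu]
    have hx' : 0 < ∑ i, ((u i).ofLp ⬝ᵥ x) ^ 2 := by
      rw [sum_sq_dotProduct_basis]
      simpa using dotProduct_star_self_pos_iff.2 hx
    obtain ⟨i, hi, hpos⟩ := Finset.exists_lt_of_sum_lt (s := Finset.univ)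
      (f := fun _ : Fin n => (0 : ℝ)) (by simpa using hx')
    exact Finset.sum_pos' (fun j _ => mul_nonneg (hd j).le (sq_nonneg _))
      ⟨i, hi, mul_pos (hd i) hpos⟩

/-- Conversely, `2 h_k(M)` is the infimum of `‖X⁻¹‖_(k) + tr(X M)`; the perturbation `δ` is needed
as `M` may be singular. -/
theorem exists_kyFan_inv_add_trace_le {M : Matrix m m ℝ} (hM : M.PosSemidef) {k : ℕ} (hk : 1 ≤ k)
    (hkm : k ≤ Fintype.card m) {δ : ℝ} (hδ : 0 < δ) :
    ∃ X : Matrix m m ℝ, X.PosDef ∧ kyFan k X⁻¹ + (X * M).trace ≤ 2 * hFun k M + k * δ := by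
  obtain ⟨u, hu⟩ := exists_eigenbasis hM.1
  have hy : ∀ i, 0 < flatSqrt k M i + δ := fun i => by
    have : 0 ≤ flatSqrt k M i := by
      rw [flatSqrt]; split_ifs
      exacts [Real.sqrt_nonneg _, level_nonneg k M]
    linarith
  obtain ⟨X, hX, hXu⟩ := exists_posDef_of_eigenbasis u
    (d := fun i => (flatSqrt k M i + δ)⁻¹) fun i => inv_pos.2 (hy i)
  have hXu' : ∀ i, X⁻¹ *ᵥ (u i).ofLp = (flatSqrt k M i + δ) • (u i).ofLp := by
    intro i
    have h : (u i).ofLp = (flatSqrt k M i + δ) • X *ᵥ (u i).ofLp := by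
      rw [hXu, smul_smul, mul_inv_cancel₀ (hy i).ne', one_smul]
    conv_lhs => rw [h]
    rw [mulVec_smul, mulVec_mulVec, nonsing_inv_mul _ hX.det_pos.ne'.isUnit, one_mulVec]
  have hh := hFun_eq hM hk hkm
  have hL := mul_level_sq hM hk hkm
  have hlt := sub_threshold_pos hM hk hkm
  have hc0 := level_nonneg k M
  refine ⟨X, hX, ?_⟩
  have h1 : kyFan k X⁻¹ ≤ hFun k M + k * δ := by
    refine (kyFan_le_of_eigenbasis hX.inv.1 hkm u hXu' (c := level k M + δ)
      (t := threshold k M) (z := fun i => √(eig M i) + δ) (by linarith)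
      ((threshold_lt hM hk hkm).le.trans hkm) ?_ ?_ ?_).trans_eq ?_
    · intro i hi
      rw [flatSqrt, if_pos hi]
    · intro i hi
      rw [flatSqrt, if_pos hi]
      linarith [level_le_sqrt_eig hM hk hkm hi]
    · intro i hi
      rw [flatSqrt, if_neg (not_lt.2 hi)]
    · rw [hh, Finset.sum_add_distrib]
      simp only [Finset.sum_const, Finset.card_range, nsmul_eq_mul]
      ring
  have h2 : (X * M).trace ≤ hFun k M := by
    have htr : (X * M).trace =
        ∑ i : Fin (Fintype.card m), eig M i * (flatSqrt k M i + δ)⁻¹ := by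
      rw [trace_eq_sum_basis u]
      refine Finset.sum_congr rfl fun i _ => ?_
      rw [← mulVec_mulVec, hu, mulVec_smul, hXu, dotProduct_smul, dotProduct_smul,
        dotProduct_basis_self, smul_eq_mul, smul_eq_mul, mul_one]
    rw [htr, sum_split_threshold hM hk hkm fun i => eig M i * (flatSqrt k M i + δ)⁻¹, hh]
    refine add_le_add (Finset.sum_le_sum fun i hi => ?_) ?_
    · rw [flatSqrt, if_pos (Finset.mem_range.1 hi), ← div_eq_mul_inv]
      refine div_le_of_le_mul₀ (by positivity) (Real.sqrt_nonneg _) ?_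
      nlinarith [Real.sq_sqrt (eig_nonneg hM i), Real.sqrt_nonneg (eig M i)]
    · have : ∀ i ∈ Finset.Ico (threshold k M) (Fintype.card m),
          eig M i * (flatSqrt k M i + δ)⁻¹ = eig M i * (level k M + δ)⁻¹ := fun i hi => by
        rw [flatSqrt, if_neg (not_lt.2 (Finset.mem_Ico.1 hi).1)]
      rw [Finset.sum_congr rfl this, ← Finset.sum_mul, ← div_eq_mul_inv]
      change tail M (threshold k M) / _ ≤ _
      rw [← hL]
      refine div_le_of_le_mul₀ (by positivity) (by positivity) ?_
      nlinarith [mul_nonneg (mul_nonneg hlt.le hc0) hδ.le]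
  linarith

/-! ### Attainment in the primal program -/

theorem kyFan_inv_pos {X : Matrix m m ℝ} (hX : X.PosDef) {k : ℕ} (hk : 1 ≤ k)
    (hkm : k ≤ Fintype.card m) : 0 < kyFan k X⁻¹ := by
  have : Nonempty m := Fintype.card_pos_iff.1 (by omega)
  obtain ⟨i⟩ := ‹Nonempty m›
  have h1 := hX.inv.dotProduct_mulVec_pos (x := Pi.single i 1) (by simp)
  have h2 := quadForm_le_kyFan_mul hX.inv.posSemidef hk (Pi.single i 1)
  rw [star_trivial] at h1
  simp only [single_dotProduct, Pi.single_eq_same, mul_one] at h2 h1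
  linarith

theorem kyFan_inv_smul_le {X : Matrix m m ℝ} (hX : X.PosDef) {k : ℕ}
    (hkm : k ≤ Fintype.card m) {r : ℝ} (hr : 0 < r) :
    kyFan k (r • X)⁻¹ ≤ r⁻¹ * kyFan k X⁻¹ := by
  have hrX : (r • X).PosDef := hX.smul hr
  obtain ⟨w, hw⟩ := exists_eigenbasis hrX.inv.1
  rw [kyFan_eq_sum_quadForm hkm hw]
  have hinv : (r • X)⁻¹ = r⁻¹ • X⁻¹ := by
    refine inv_eq_right_inv ?_
    rw [smul_mul_smul_comm, mul_inv_cancel₀ hr.ne', mul_nonsing_inv _ hX.det_pos.ne'.isUnit,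
      one_smul]
  refine le_trans (le_of_eq ?_) (mul_le_mul_of_nonneg_left
    (sum_weights_quadForm_le_kyFan hX.inv.posSemidef hkm w
      (v := fun i => if (i : ℕ) < k then 1 else 0)
      (fun i => by split_ifs <;> norm_num)
      (fun i => by split_ifs <;> norm_num)
      (sum_indicator_lt hkm).le) (inv_pos.2 hr).le)
  rw [Finset.mul_sum]
  refine Finset.sum_congr rfl fun i _ => ?_
  rw [hinv, smul_mulVec, dotProduct_smul, smul_eq_mul]
  ring

/-- A bound on `‖X⁻¹‖_(k)` bounds the quadratic form of `X` away from `0`. -/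
theorem dotProduct_self_le_mul_quadForm {X : Matrix m m ℝ} (hX : X.PosDef) {k : ℕ} (hk : 1 ≤ k)
    {B : ℝ} (hB : kyFan k X⁻¹ ≤ B) (x : m → ℝ) : x ⬝ᵥ x ≤ B * (x ⬝ᵥ X *ᵥ x) := by
  rcases eq_or_ne x 0 with rfl | hx
  · simp
  have hxx : 0 < x ⬝ᵥ x := by simpa using dotProduct_star_self_pos_iff.2 hx
  have hq : 0 < x ⬝ᵥ X *ᵥ x := by simpa using hX.dotProduct_mulVec_pos hx
  set q := x ⬝ᵥ X *ᵥ x with hqd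
  set s := x ⬝ᵥ x with hs
  have h1 := two_mul_dotProduct_sub_le hX x ((s / q) • x)
  simp only [smul_dotProduct, mulVec_smul, dotProduct_smul, smul_eq_mul, ← hqd, ← hs] at h1
  have h2 := quadForm_le_kyFan_mul hX.inv.posSemidef hk x
  have h3 : 2 * (s / q * s) - s / q * (s / q * q) = s * s / q := by field_simp; ring
  rw [h3] at h1
  have h4 : s * s / q ≤ B * s := h1.trans (h2.trans (mul_le_mul_of_nonneg_right hB hxx.le))
  rw [div_le_iff₀ hq] at h4
  exact le_of_mul_le_mul_right (by linarith) hxx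

theorem abs_bilin_le_one {X : Matrix m m ℝ} (hX : X.PosSemidef) {a b : m → ℝ}
    (ha : a ⬝ᵥ X *ᵥ a ≤ 1) (hb : b ⬝ᵥ X *ᵥ b ≤ 1) : |a ⬝ᵥ X *ᵥ b| ≤ 1 := by
  have hsymm : b ⬝ᵥ X *ᵥ a = a ⬝ᵥ X *ᵥ b := by
    have : Xᵀ = X := by simpa using hX.1.eq
    rw [dotProduct_mulVec, ← mulVec_transpose, dotProduct_comm, this]
  have h1 := hX.dotProduct_mulVec_nonneg (a - b)
  have h2 := hX.dotProduct_mulVec_nonneg (a + b)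
  simp only [star_trivial, mulVec_sub, mulVec_add, sub_dotProduct, add_dotProduct,
    dotProduct_sub, dotProduct_add, hsymm] at h1 h2
  rw [abs_le]
  constructor <;> linarith

variable {U : Type*} [Fintype U]

theorem exists_right_inverse_of_rank {A : Matrix m U ℝ} (hA : A.rank = Fintype.card m) :
    ∃ Z : Matrix U m ℝ, A * Z = 1 := by
  classical
  refine mulVec_surjective_iff_exists_right_inverse.1 ?_
  have h : LinearMap.range A.mulVecLin = ⊤ :=
    Submodule.eq_top_of_finrank_eq (by rw [← Matrix.rank, hA, Module.finrank_fintype_fun_eq_card])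
  exact LinearMap.range_eq_top.1 h

theorem transpose_mul_mul_apply (A : Matrix m U ℝ) (X : Matrix m m ℝ) (e f : U) :
    (Aᵀ * X * A) e f = A.col e ⬝ᵥ X *ᵥ A.col f := by
  rw [Matrix.mul_assoc, mul_apply']
  rfl

/-- The set of feasible `X` with `x ⬝ᵥ x ≤ B * (x ⬝ᵥ X *ᵥ x)` is compact: with a right inverse `Z`
of `A` one has `X = Zᵀ (Aᵀ X A) Z`, and the entries of `Aᵀ X A` lie in `[-1, 1]`. -/
theorem isCompact_feasible {A : Matrix m U ℝ} (hA : A.rank = Fintype.card m) (B : ℝ)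
    (hB : 0 < B) :
    IsCompact {X : Matrix m m ℝ | X.IsHermitian ∧ (∀ e, A.col e ⬝ᵥ X *ᵥ A.col e ≤ 1) ∧
      ∀ x : m → ℝ, x ⬝ᵥ x ≤ B * (x ⬝ᵥ X *ᵥ x)} := by
  obtain ⟨Z, hZ⟩ := exists_right_inverse_of_rank hA
  have hcomp : IsCompact {N : Matrix U U ℝ | ∀ e f, N e f ∈ Set.Icc (-1 : ℝ) 1} := by
    have := isCompact_univ_pi (fun _ : U => isCompact_univ_pi
      fun _ : U => isCompact_Icc (a := (-1 : ℝ)) (b := 1))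
    change IsCompact {N : U → U → ℝ | ∀ e f, N e f ∈ Set.Icc (-1 : ℝ) 1}
    convert this using 1
    ext N
    exact ⟨fun h e _ f _ => h e f, fun h e f => h e trivial f trivial⟩
  refine (hcomp.image (f := fun N => Zᵀ * N * Z) (by fun_prop)).of_isClosed_subset ?_ ?_
  · refine IsClosed.inter ?_ (IsClosed.inter ?_ ?_)
    · exact isClosed_eq (by fun_prop) continuous_id
    · change IsClosed {X : Matrix m m ℝ | ∀ e, A.col e ⬝ᵥ X *ᵥ A.col e ≤ 1}
      simp only [Set.ofPred_forall]
      exact isClosed_iInter fun e => isClosed_le (by fun_prop) continuous_const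
    · change IsClosed {X : Matrix m m ℝ | ∀ x : m → ℝ, x ⬝ᵥ x ≤ B * (x ⬝ᵥ X *ᵥ x)}
      simp only [Set.ofPred_forall]
      exact isClosed_iInter fun x => isClosed_le continuous_const (by fun_prop)
  · rintro X ⟨hX, hfeas, hlow⟩
    have hpsd : X.PosSemidef := .of_dotProduct_mulVec_nonneg hX fun x => by
      have h0 : 0 ≤ x ⬝ᵥ x := by simpa using dotProduct_star_self_nonneg x
      exact nonneg_of_mul_nonneg_right (h0.trans (hlow x)) hB
    refine ⟨Aᵀ * X * A, fun e f => ?_, ?_⟩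
    · rw [transpose_mul_mul_apply]
      exact abs_le.1 (abs_bilin_le_one hpsd (hfeas e) (hfeas f))
    · calc Zᵀ * (Aᵀ * X * A) * Z = (A * Z)ᵀ * X * (A * Z) := by
            simp only [transpose_mul, Matrix.mul_assoc]
        _ = X := by rw [hZ]; simp

theorem exists_isLeast_primalValues {A : Matrix m U ℝ} (hA : A.rank = Fintype.card m) {k : ℕ}
    (hk : 1 ≤ k) (hkm : k ≤ Fintype.card m) : ∃ μ, IsLeast (primalValues k A) μ := by
  -- A small multiple of the identity matrix is feasible.
  obtain ⟨X₀, hX₀, hf₀⟩ : ∃ X : Matrix m m ℝ, X.PosDef ∧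
      ∀ e, A.col e ⬝ᵥ X *ᵥ A.col e ≤ 1 := by
    have hs : 0 ≤ ∑ e, A.col e ⬝ᵥ A.col e :=
      Finset.sum_nonneg fun e _ => by simpa using dotProduct_star_self_nonneg (A.col e)
    refine ⟨(1 + ∑ e, A.col e ⬝ᵥ A.col e)⁻¹ • (1 : Matrix m m ℝ),
      PosDef.one.smul (by positivity), fun e => ?_⟩
    rw [smul_mulVec, one_mulVec, dotProduct_smul, smul_eq_mul, inv_mul_le_one₀ (by positivity)]
    have := Finset.single_le_sum (f := fun e => A.col e ⬝ᵥ A.col e)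
      (fun e _ => by simpa using dotProduct_star_self_nonneg (A.col e)) (Finset.mem_univ e)
    linarith
  set B := kyFan k X₀⁻¹
  have hB : 0 < B := kyFan_inv_pos hX₀ hk hkm
  set K := {X : Matrix m m ℝ | X.IsHermitian ∧ (∀ e, A.col e ⬝ᵥ X *ᵥ A.col e ≤ 1) ∧
      ∀ x : m → ℝ, x ⬝ᵥ x ≤ B * (x ⬝ᵥ X *ᵥ x)} with hK
  have hmem : ∀ X : Matrix m m ℝ, X.PosDef → (∀ e, A.col e ⬝ᵥ X *ᵥ A.col e ≤ 1) →
      kyFan k X⁻¹ ≤ B → X ∈ K := fun X hX hf hle =>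
    ⟨hX.1, hf, fun x => dotProduct_self_le_mul_quadForm hX hk hle x⟩
  have hsub : K ⊆ {X | X.PosDef} := by
    rintro X ⟨hX, -, hlow⟩
    refine .of_dotProduct_mulVec_pos hX fun x hx => ?_
    have hxx : 0 < x ⬝ᵥ x := by simpa using dotProduct_star_self_pos_iff.2 hx
    exact pos_of_mul_pos_right (hxx.trans_le (hlow x)) hB.le
  obtain ⟨X, hX, hmin⟩ := ((lowerSemicontinuousOn_kyFan_inv hkm).mono hsub).exists_isMinOn
    ⟨X₀, hmem X₀ hX₀ hf₀ le_rfl⟩ (isCompact_feasible hA B hB)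
  refine ⟨kyFan k X⁻¹, ⟨X, hsub hX, hX.2.1, rfl⟩, ?_⟩
  rintro _ ⟨Y, hY, hf, rfl⟩
  by_cases hle : kyFan k Y⁻¹ ≤ B
  · exact hmin (hmem Y hY hf hle)
  · exact (hmin (hmem X₀ hX₀ hf₀ le_rfl)).trans (not_le.1 hle).le

/-! ### Strong duality -/

/-- The scale-free form of the primal program: `2 √μ ≤ ‖X⁻¹‖_(k) + max_e a_eᵀ X a_e`. -/
theorem exists_two_mul_sqrt_le {A : Matrix m U ℝ} (hA : A.rank = Fintype.card m) {k : ℕ}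
    (hk : 1 ≤ k) (hkm : k ≤ Fintype.card m) {μ : ℝ} (hμ : μ ∈ lowerBounds (primalValues k A))
    {X : Matrix m m ℝ} (hX : X.PosDef) :
    ∃ e, 2 * √μ ≤ kyFan k X⁻¹ + A.col e ⬝ᵥ X *ᵥ A.col e := by
  obtain ⟨Z, hZ⟩ := exists_right_inverse_of_rank hA
  have hne : ∃ e, A.col e ≠ 0 := by
    by_contra! h
    have hA0 : A = 0 := by ext i e; exact congrFun (h e) i
    rw [hA0, rank_zero] at hA
    omega
  obtain ⟨e₀, he₀⟩ := hne
  obtain ⟨e, -, he⟩ := Finset.exists_max_image Finset.univ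
    (fun e => A.col e ⬝ᵥ X *ᵥ A.col e) ⟨e₀, Finset.mem_univ _⟩
  refine ⟨e, ?_⟩
  set s := A.col e ⬝ᵥ X *ᵥ A.col e
  have hs : 0 < s := by
    have := hX.dotProduct_mulVec_pos he₀
    rw [star_trivial] at this
    exact this.trans_le (he e₀ (Finset.mem_univ _))
  have hle : μ ≤ s * kyFan k X⁻¹ := by
    have h := hμ ⟨s⁻¹ • X, hX.smul (inv_pos.2 hs), fun f => by
      rw [smul_mulVec, dotProduct_smul, smul_eq_mul, inv_mul_le_one₀ hs]
      exact he f (Finset.mem_univ _), rfl⟩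
    have h' := kyFan_inv_smul_le hX hkm (inv_pos.2 hs)
    rw [inv_inv] at h'
    exact h.trans h'
  have hK := kyFan_inv_pos hX hk hkm
  have : √μ ≤ (kyFan k X⁻¹ + s) / 2 := by
    refine Real.sqrt_le_iff.2 ⟨by positivity, hle.trans ?_⟩
    nlinarith [sq_nonneg (kyFan k X⁻¹ - s)]
  linarith

/-- The minimax step: a single probability vector `q` works for all `X`. -/
theorem exists_stdSimplex_forall_two_mul_sqrt_le {A : Matrix m U ℝ}
    (hA : A.rank = Fintype.card m) {k : ℕ} (hk : 1 ≤ k) (hkm : k ≤ Fintype.card m) {μ : ℝ}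
    (hμ : μ ∈ lowerBounds (primalValues k A)) :
    ∃ q ∈ stdSimplex ℝ U, ∀ X : Matrix m m ℝ, X.PosDef →
      2 * √μ ≤ kyFan k X⁻¹ + ∑ e, q e * (A.col e ⬝ᵥ X *ᵥ A.col e) := by
  classical
  have hU : Nonempty U := ⟨(exists_two_mul_sqrt_le hA hk hkm hμ PosDef.one).choose⟩
  let g : Matrix m m ℝ → (U → ℝ) → ℝ := fun X q => ∑ e, q e * (A.col e ⬝ᵥ X *ᵥ A.col e)
  let f : (U → ℝ) → Matrix m m ℝ → ℝ := fun q X => -(kyFan k X⁻¹ + g X q)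
  have hne : (stdSimplex ℝ U).Nonempty := ⟨_, single_mem_stdSimplex ℝ hU.some⟩
  have hlsc : ∀ X ∈ {X : Matrix m m ℝ | X.PosDef},
      LowerSemicontinuousOn (fun q => f q X) (stdSimplex ℝ U) := fun X _ => by
    have : Continuous fun q => f q X := by simp only [f, g]; fun_prop
    exact this.lowerSemicontinuous.lowerSemicontinuousOn _
  have hqcv : ∀ X ∈ {X : Matrix m m ℝ | X.PosDef},
      QuasiconvexOn ℝ (stdSimplex ℝ U) (fun q => f q X) := fun X _ => by
    refine ConvexOn.quasiconvexOn ⟨convex_stdSimplex ℝ U, fun p _ q _ a b _ _ hab => le_of_eq ?_⟩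
    have hg : g X (a • p + b • q) = a * g X p + b * g X q := by
      simp only [g, Pi.add_apply, Pi.smul_apply, smul_eq_mul, Finset.mul_sum,
        ← Finset.sum_add_distrib]
      exact Finset.sum_congr rfl fun e _ => by ring
    simp only [f, hg, smul_eq_mul]
    linear_combination (kyFan k X⁻¹) * hab
  have husc : ∀ q ∈ stdSimplex ℝ U,
      UpperSemicontinuousOn (fun X => f q X) {X : Matrix m m ℝ | X.PosDef} := fun q _ => by
    have hg : Continuous fun X => g X q := by simp only [g]; fun_prop
    have := (lowerSemicontinuousOn_kyFan_inv hkm).add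
      (hg.lowerSemicontinuous.lowerSemicontinuousOn {X : Matrix m m ℝ | X.PosDef})
    exact this.neg
  have hqcc : ∀ q ∈ stdSimplex ℝ U,
      QuasiconcaveOn ℝ {X : Matrix m m ℝ | X.PosDef} (fun X => f q X) := fun q _ => by
    refine ConcaveOn.quasiconcaveOn ⟨convex_posDef, fun X hX Y hY a b ha hb hab => ?_⟩
    have hg : g (a • X + b • Y) q = a * g X q + b * g Y q := by
      simp only [g, add_mulVec, smul_mulVec, dotProduct_add, dotProduct_smul, smul_eq_mul,
        Finset.mul_sum, ← Finset.sum_add_distrib]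
      exact Finset.sum_congr rfl fun e _ => by ring
    have h := (convexOn_kyFan_inv hkm).2 hX hY ha hb hab
    simp only [smul_eq_mul] at h
    simp only [f, hg, smul_eq_mul]
    linarith
  by_contra! hcon
  -- By compactness finitely many `X` defeat all `q`; then a single one does.
  have hempty : stdSimplex ℝ U ∩ ⋂ X ∈ {X : Matrix m m ℝ | X.PosDef},
      (fun q => f q X) ⁻¹' Set.Iic (-(2 * √μ)) = ∅ := by
    refine Set.eq_empty_of_forall_notMem fun q hq => ?_
    obtain ⟨X, hX, hlt⟩ := hcon q hq.1
    have h := Set.mem_iInter₂.1 hq.2 X hX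
    simp only [Set.mem_preimage, Set.mem_Iic, f, g, neg_le_neg_iff] at h
    exact absurd h (not_le.2 hlt)
  obtain ⟨F, hF⟩ := (LowerSemicontinuousOn.inter_biInter_preimage_Iic_eq_empty_iff_exists_finset
    (isCompact_stdSimplex ℝ U) hlsc).1 hempty
  obtain ⟨X, hX, hlt⟩ := Sion.exists_lt_iInf_of_lt_iInf_of_finite hne (isCompact_stdSimplex ℝ U)
    hlsc hqcv convex_posDef husc hqcc (convex_stdSimplex ℝ U)
    (s := Subtype.val '' (F : Set {X : Matrix m m ℝ | X.PosDef})) (Set.toFinite _)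
    (Subtype.coe_image_subset _ _) (t := -(2 * √μ)) fun q hq => by
      obtain ⟨X, hX, hlt⟩ := hF q hq
      exact ⟨X, ⟨X, hX, rfl⟩, hlt⟩
  obtain ⟨e, he⟩ := exists_two_mul_sqrt_le hA hk hkm hμ hX
  have h := hlt _ (single_mem_stdSimplex ℝ e)
  simp only [f, g, neg_lt_neg_iff, Pi.single_apply, ite_mul, one_mul, zero_mul,
    Finset.sum_ite_eq', Finset.mem_univ, if_true] at h
  linarith

theorem trace_mul_conj_diagonal [DecidableEq U] (A : Matrix m U ℝ) (X : Matrix m m ℝ)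
    (q : U → ℝ) : (X * (A * diagonal q * Aᵀ)).trace =
      ∑ e, q e * (A.col e ⬝ᵥ X *ᵥ A.col e) := by
  have : (X * (A * diagonal q * Aᵀ)).trace = ((Aᵀ * X * A) * diagonal q).trace := by
    rw [Matrix.mul_assoc A, trace_mul_comm, Matrix.mul_assoc, trace_mul_comm,
      Matrix.mul_assoc, Matrix.mul_assoc, trace_mul_comm]
    simp only [Matrix.mul_assoc]
  rw [this]
  simp only [trace, diag_apply, mul_diagonal, transpose_mul_mul_apply, mul_comm]

theorem posSemidef_conj_diagonal [DecidableEq U] (A : Matrix m U ℝ) {q : U → ℝ}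
    (hq : ∀ e, 0 ≤ q e) : (A * diagonal q * Aᵀ).PosSemidef := by
  simpa using (PosSemidef.diagonal (n := U) (d := q) hq).mul_mul_conjTranspose_same A

end KyFanDual

theorem theorem3 {S U : Type*} [Fintype S] [DecidableEq S] [Fintype U]
    (A : Matrix S U ℝ) (hA : A.rank = Fintype.card S)
    (k : ℕ) (hk : 1 ≤ k) (hkS : k ≤ Fintype.card S) :
    ∃ μ : ℝ, IsLeast (KyFanDual.primalValues k A) μ ∧
      IsGreatest (KyFanDual.dualValues k A) μ := by
  classical
  open KyFanDual in
  obtain ⟨μ, hμ⟩ := exists_isLeast_primalValues hA hk hkS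
  obtain ⟨X, hX, hfeas, hμX⟩ := hμ.1
  have hμ0 : 0 ≤ μ := hμX ▸ (kyFan_inv_pos hX hk hkS).le
  have weak : ∀ q : U → ℝ, (∀ e, 0 ≤ q e) → ∑ e, q e = 1 →
      hFun k (A * Matrix.diagonal q * A.transpose) ^ 2 ≤ μ := by
    intro q hq hq1
    rw [hμX]
    refine hFun_sq_le_kyFan_inv (posSemidef_conj_diagonal A hq) hk hkS hX ?_
    rw [trace_mul_conj_diagonal, ← hq1]
    exact Finset.sum_le_sum fun e _ => mul_le_of_le_one_right (hq e) (hfeas e)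
  refine ⟨μ, hμ, ?_, ?_⟩
  · obtain ⟨q, ⟨hq, hq1⟩, hle⟩ := exists_stdSimplex_forall_two_mul_sqrt_le hA hk hkS hμ.2
    refine ⟨Matrix.diagonal q, Matrix.PosSemidef.diagonal hq, Matrix.isDiag_diagonal q, ?_,
      le_antisymm ?_ (weak q hq hq1)⟩
    · rw [Matrix.trace_diagonal, hq1]
    · have hk0 : (0 : ℝ) < k := by exact_mod_cast hk
      have h : √μ ≤ hFun k (A * Matrix.diagonal q * A.transpose) := by
        refine le_of_forall_pos_le_add fun ε hε => ?_
        obtain ⟨Y, hY, hYle⟩ := exists_kyFan_inv_add_trace_le (posSemidef_conj_diagonal A hq)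
          hk hkS (δ := 2 * ε / k) (by positivity)
        rw [trace_mul_conj_diagonal, mul_div_cancel₀ _ hk0.ne'] at hYle
        linarith [hle Y hY]
      calc μ = √μ ^ 2 := (Real.sq_sqrt hμ0).symm
        _ ≤ _ := pow_le_pow_left₀ (Real.sqrt_nonneg _) h 2
  · rintro _ ⟨Q, hQ, hdiag, htr, rfl⟩
    rw [← hdiag.diagonal_diag]
    exact weak _ (fun e => hQ.diag_nonneg) htr
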